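/- Let $\mathcal M=(E,\mathcal I)$ be a matroid on a finite ground set $E$ with rank function $r$, and let $w\in\mathbb R_{\ge 0}^E$. Let $r_w(S)=\max\{w(T): T\subseteq S,\ T\in\mathcal I\}$ be the weighted rank function, where $w(T)=\sum_{i\in T}w_i$. For $x\in[0,1]^E$ let $$R_w(x)=\sum_{S\subseteq E} r_w(S)\prod_{i\in S}x_i\prod_{i\notin S}(1-x_i)$$ be its multilinear extension, let $$\hat r_w(x)=\max\Big\{\sum_{S\subseteq E}\lambda_S r_w(S)\ :\ \lambda\ge 0,\ \sum_{S\subseteq E}\lambda_S=1,\ \sum_{S\ni i}\lambda_S=x_i\ \text{ for all } i\in E\Big\}$$ be its concave extension, and let $$\mathcal{CG}(r_w)=\inf_{x\in[0,1]^E}\frac{R_w(x)}{\hat r_w(x)}$$ be its correlation gap, with the convention $0/0=1$ (used throughout). Let $\mathcal P(r)=\{x\in\mathbb R_{\ge 0}^E : \sum_{i\in S}x_i\le r(S)\text{ for all }S\subseteq E\}$ be the independent set polytope. Then there exists a point $x^*\in\mathcal P(r)$ such that $$\sum_{i\in E}x^*_i=r(\operatorname{supp}(x^*)),\qquad\text{where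 } \operatorname{supp}(x^*)=\{i\in E: x^*_i\neq 0\},$$ and $$\mathcal{CG}(r_w)=\frac{R_w(x^*)}{\hat r_w(x^*)}=\frac{R_w(x^*)}{w^\top x^*}.$$ -/

import Mathlib

namespace CorrelationGap

noncomputable section

variable {E : Type*} [Fintype E] [DecidableEq E]

/-- The multilinear extension
`F(x) = ∑_{S ⊆ E} f(S) ∏_{i ∈ S} x_i ∏_{i ∉ S} (1 - x_i)` of a set function `f`. -/
def multilinearExt (f : Finset E → ℝ) (x : E → ℝ) : ℝ :=
  ∑ S : Finset E, f S * ((∏ i ∈ S, x i) * ∏ i ∈ Sᶜ, (1 - x i))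

/-- The probability distributions `lam` on the subsets of `E` with marginals `x`. -/
def marginalDistributions (x : E → ℝ) : Set (Finset E → ℝ) :=
  {lam | (∀ S, 0 ≤ lam S) ∧ ∑ S, lam S = 1 ∧ ∀ i, ∑ S with i ∈ S, lam S = x i}

/-- The concave extension: the largest value of `∑_S lam_S f(S)` over the probability
distributions `lam` on subsets with marginals `x`. For `x ∈ [0,1]^E` the set of these
distributions is nonempty and compact, so the supremum is a maximum. -/
def concaveExt (f : Finset E → ℝ) (x : E → ℝ) : ℝ :=
  sSup ((fun lam : Finset E → ℝ => ∑ S, lam S * f S) '' marginalDistributions x)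

/-- The quotient `a / b` with the convention `0 / 0 = 1`. -/
def ratio (a b : ℝ) : ℝ := if a = 0 ∧ b = 0 then 1 else a / b

/-- The correlation gap: the infimum of `F(x) / f̂(x)` over the cube `[0,1]^E`. -/
def correlationGap (f : Finset E → ℝ) : ℝ :=
  sInf ((fun x : E → ℝ => ratio (multilinearExt f x) (concaveExt f x)) ''
    {x | ∀ i, 0 ≤ x i ∧ x i ≤ 1})

open Classical in
/-- The weighted rank function `r_w(S) = max {w(T) : T ⊆ S, T independent}`. -/
def weightedRank (M : Matroid E) (w : E → ℝ) (S : Finset E) : ℝ :=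
  (S.powerset.filter fun T => M.Indep (T : Set E)).sup' ⟨∅, by simp⟩ fun T => ∑ i ∈ T, w i

/-- The rank function `r(S)` of a matroid on a finite type, as a natural number. -/
def rank (M : Matroid E) (S : Finset E) : ℕ := (M.eRk (S : Set E)).toNat

/-- The independent set polytope `{x ≥ 0 : x(S) ≤ r(S) for all S ⊆ E}`. -/
def indepPolytope (M : Matroid E) : Set (E → ℝ) :=
  {x | (∀ i, 0 ≤ x i) ∧ ∀ S : Finset E, ∑ i ∈ S, x i ≤ (rank M S : ℝ)}

open Classical in
/-- The support `{i : x_i ≠ 0}`. -/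
def supp (x : E → ℝ) : Finset E := Finset.univ.filter fun i => x i ≠ 0

end

end CorrelationGap

/-! Write `R` for the multilinear extension of the weighted rank and `P` for the independent set
polytope. Three reductions bring the infimum from the cube to the tight points of `P`.

From the cube to `P`: given a distribution with marginals `x`, replace each set `S` by a
maximum-weight independent subset. The new marginals `y ≤ x` lie in `P` and `w · y` is the old
value, while `R y ≤ R x` by monotonicity (`exists_mem_indepPolytope_le`). On `P` the concave
extension is `w · y`, by Edmonds' theorem (`concaveExt_of_mem_indepPolytope`).

To positive weights: zeroing the coordinates of weight 0 keeps `w · y` and does not increase `R`.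

To tight support: for fixed `c`, the function `R y - c * (w · y)` is affine in each coordinate. A
coordinate of the support in no tight set can go down to 0 or up until a set becomes tight, and one
of the two moves does not increase the function. When no such coordinate is left, uncrossing makes
the support tight (`nonneg_of_nonneg_of_tight`).

The nonzero tight points supported on positive weights form a compact set on which `w · x > 0`, so
the quotient attains its minimum there; this minimum is the correlation gap. If there are none, the
gap is 1, attained at 0. -/

namespace CorrelationGap

/-! ### Multilinear extension: product distribution, affinity, monotonicity -/

section Multilinear

variable {E : Type*} [Fintype E] [DecidableEq E]

/-- The probability of the set `S` under independent sampling with marginals `x`. -/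
def productWeight (x : E → ℝ) (S : Finset E) : ℝ :=
  (∏ i ∈ S, x i) * ∏ i ∈ Sᶜ, (1 - x i)

lemma productWeight_nonneg {x : E → ℝ} (hx : ∀ i, 0 ≤ x i ∧ x i ≤ 1) (S : Finset E) :
    0 ≤ productWeight x S :=
  mul_nonneg (Finset.prod_nonneg fun i _ => (hx i).1)
    (Finset.prod_nonneg fun i _ => sub_nonneg.2 (hx i).2)

lemma multilinearExt_eq (f : Finset E → ℝ) (x : E → ℝ) :
    multilinearExt f x = ∑ S, productWeight x S * f S :=
  Finset.sum_congr rfl fun _ _ => mul_comm _ _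

lemma sum_productWeight (x : E → ℝ) : ∑ S, productWeight x S = 1 := by
  have h := Finset.prod_add (fun i => x i) (fun i => 1 - x i) Finset.univ
  simp only [add_sub_cancel, Finset.prod_const_one, Finset.powerset_univ] at h
  rw [h]
  exact Finset.sum_congr rfl fun S _ => by rw [productWeight, Finset.compl_eq_univ_sdiff]

lemma sum_productWeight_mem (x : E → ℝ) (i : E) :
    ∑ S with i ∈ S, productWeight x S = x i := by
  -- Dropping the summand `1 - x i` from the factor at `i` leaves in the expansion exactly the sets
  -- containing `i`.
  have h := Finset.prod_add x (fun j => if j = i then 0 else 1 - x j) Finset.univ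
  have hl : ∏ j, (x j + if j = i then 0 else 1 - x j) = x i := by
    rw [Finset.prod_eq_single i]
    · simp
    · intro j _ hj
      simp [hj]
    · simp
  rw [hl, Finset.powerset_univ] at h
  rw [h, Finset.sum_filter]
  refine Finset.sum_congr rfl fun S _ => ?_
  rw [productWeight, ← Finset.compl_eq_univ_sdiff]
  split_ifs with hi
  · congr 1
    refine Finset.prod_congr rfl fun j hj => ?_
    rw [if_neg]
    rintro rfl
    exact Finset.mem_compl.1 hj hi
  · rw [Finset.prod_eq_zero (Finset.mem_compl.2 hi) (by simp), mul_zero]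

lemma productWeight_mem_marginalDistributions {x : E → ℝ} (hx : ∀ i, 0 ≤ x i ∧ x i ≤ 1) :
    productWeight x ∈ marginalDistributions x :=
  ⟨productWeight_nonneg hx, sum_productWeight x, sum_productWeight_mem x⟩

/-- The multilinear extension is affine in each coordinate, and increasing in it on the cube
if the set function is monotone. -/
lemma exists_multilinearExt_update_eq (f : Finset E → ℝ) (x : E → ℝ) (i : E) :
    ∃ a b : ℝ, (∀ t, multilinearExt f (Function.update x i t) = a + b * t) ∧
      (Monotone f → (∀ j, 0 ≤ x j ∧ x j ≤ 1) → 0 ≤ b) := by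
  let U : Finset E := Finset.univ.erase i
  -- `q T` is the probability of sampling `T` from the elements other than `i`; conditioning on `i`
  -- gives the affine formula.
  let q : Finset E → ℝ := fun T => (∏ j ∈ T, x j) * ∏ j ∈ U \ T, (1 - x j)
  have hiU : i ∉ U := Finset.notMem_erase i _
  have hU : Finset.univ = insert i U := (Finset.insert_erase (Finset.mem_univ i)).symm
  have h1 : ∀ t, ∀ T ∈ U.powerset,
      productWeight (Function.update x i t) T = q T * (1 - t) := by
    intro t T hT
    have hiT : i ∉ T := fun h => hiU (Finset.mem_powerset.1 hT h)
    have hc : Tᶜ = insert i (U \ T) := by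
      rw [Finset.compl_eq_univ_sdiff, hU, Finset.insert_sdiff_of_notMem _ hiT]
    rw [productWeight, hc, Finset.prod_insert (by simp [hiU]), Function.update_self,
      Finset.prod_congr rfl (g := x), Finset.prod_congr (s₁ := U \ T) rfl (g := fun j => 1 - x j)]
    · simp only [q]; ring
    · intro j hj
      rw [Function.update_of_ne]
      rintro rfl
      exact hiU (Finset.mem_sdiff.1 hj).1
    · intro j hj
      rw [Function.update_of_ne]
      rintro rfl
      exact hiT hj
  have h2 : ∀ t, ∀ T ∈ U.powerset,
      productWeight (Function.update x i t) (insert i T) = q T * t := by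
    intro t T hT
    have hiT : i ∉ T := fun h => hiU (Finset.mem_powerset.1 hT h)
    have hc : (insert i T)ᶜ = U \ T := by
      ext j; simp [U]
    rw [productWeight, hc, Finset.prod_insert hiT, Function.update_self,
      Finset.prod_congr rfl (g := x), Finset.prod_congr (s₁ := U \ T) rfl (g := fun j => 1 - x j)]
    · simp only [q]; ring
    · intro j hj
      rw [Function.update_of_ne]
      rintro rfl
      exact hiU (Finset.mem_sdiff.1 hj).1
    · intro j hj
      rw [Function.update_of_ne]
      rintro rfl
      exact hiT hj
  refine ⟨∑ T ∈ U.powerset, q T * f T, ∑ T ∈ U.powerset, q T * (f (insert i T) - f T), ?_, ?_⟩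
  · intro t
    rw [multilinearExt_eq, ← Finset.powerset_univ, hU, Finset.sum_powerset_insert hiU,
      Finset.sum_mul, ← Finset.sum_add_distrib, ← Finset.sum_add_distrib]
    refine Finset.sum_congr rfl fun T hT => ?_
    rw [h1 t T hT, h2 t T hT]
    ring
  · intro hf hx
    refine Finset.sum_nonneg fun T _ => mul_nonneg (mul_nonneg ?_ ?_) ?_
    · exact Finset.prod_nonneg fun j _ => (hx j).1
    · exact Finset.prod_nonneg fun j _ => sub_nonneg.2 (hx j).2
    · exact sub_nonneg.2 (hf (Finset.subset_insert i T))

/-- Coordinates are raised from `x` to `y` one at a time; the intermediate points stay in the cube,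
where each slope is nonnegative. -/
lemma multilinearExt_mono {f : Finset E → ℝ} (hf : Monotone f) {x y : E → ℝ}
    (hx : ∀ i, 0 ≤ x i) (hxy : x ≤ y) (hy : ∀ i, y i ≤ 1) :
    multilinearExt f x ≤ multilinearExt f y := by
  have key : ∀ s : Finset E, multilinearExt f x ≤ multilinearExt f (s.piecewise y x) := by
    intro s
    induction s using Finset.induction_on with
    | empty => simp
    | insert i s his ih =>
      refine ih.trans ?_
      obtain ⟨a, b, hab, hb⟩ := exists_multilinearExt_update_eq f (s.piecewise y x) i
      have hb' : 0 ≤ b := hb hf fun j => by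
        by_cases hj : j ∈ s
        · simpa [hj] using ⟨(hx j).trans (hxy j), hy j⟩
        · simpa [hj] using ⟨hx j, (hxy j).trans (hy j)⟩
      have h0 : multilinearExt f (s.piecewise y x) = a + b * x i := by
        rw [← hab, ← Finset.piecewise_eq_of_notMem s y x his, Function.update_eq_self]
      rw [Finset.piecewise_insert, hab, h0]
      have := mul_le_mul_of_nonneg_left (hxy i) hb'
      linarith
  simpa using key Finset.univ

lemma continuous_multilinearExt (f : Finset E → ℝ) : Continuous (multilinearExt f) := by
  unfold multilinearExt
  fun_prop

end Multilinear

/-! ### Weighted rank function -/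

section WeightedRank

variable {E : Type*} [Fintype E] [DecidableEq E] {M : Matroid E} {w : E → ℝ}

omit [DecidableEq E] in
lemma exists_weightedRank_eq (M : Matroid E) (w : E → ℝ) (S : Finset E) :
    ∃ T ⊆ S, M.Indep (T : Set E) ∧ weightedRank M w S = ∑ i ∈ T, w i := by
  classical
  -- In `weightedRank` the bound variable elaborates as a `Set E`: the supremum runs over the image
  -- of the powerset in `Finset (Set E)`. The statement is proved in that form and pulled back to
  -- finsets.
  have key : ∃ T : Set E, ((∃ I ⊆ S, (I : Set E) = T) ∧ M.Indep T) ∧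
      weightedRank M w S = ∑ i ∈ T.toFinset, w i := by
    unfold weightedRank
    generalize_proofs hne
    obtain ⟨T, hT, h⟩ := Finset.exists_mem_eq_sup' hne fun T : Set E => ∑ i ∈ T.toFinset, w i
    refine ⟨T, ?_, (by convert h)⟩
    simpa [Finset.bind_def, eq_comm] using hT
  obtain ⟨-, ⟨⟨T, hTS, rfl⟩, hTi⟩, hmax⟩ := key
  exact ⟨T, hTS, hTi, by rw [hmax, Finset.toFinset_coe]⟩

omit [DecidableEq E] in
lemma le_weightedRank {S T : Finset E} (hTS : T ⊆ S) (hT : M.Indep (T : Set E)) :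
    ∑ i ∈ T, w i ≤ weightedRank M w S := by
  classical
  unfold weightedRank
  refine le_trans (le_of_eq ?_) (Finset.le_sup' _ (b := (T : Set E)) ?_)
  · simp
  · simpa [Finset.bind_def, hT] using hTS

omit [DecidableEq E] in
lemma weightedRank_mono (M : Matroid E) (w : E → ℝ) : Monotone (weightedRank M w) := by
  intro S T hST
  obtain ⟨I, hIS, hI, h⟩ := exists_weightedRank_eq M w S
  exact h ▸ le_weightedRank (hIS.trans hST) hI

omit [DecidableEq E] in
lemma weightedRank_nonneg (M : Matroid E) (w : E → ℝ) (S : Finset E) :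
    0 ≤ weightedRank M w S := by
  simpa using le_weightedRank (M := M) (w := w) (Finset.empty_subset S)
    (by rw [Finset.coe_empty]; exact M.empty_indep)

omit [DecidableEq E] in
lemma weightedRank_le (hw : ∀ i, 0 ≤ w i) (S : Finset E) :
    weightedRank M w S ≤ ∑ i ∈ S, w i := by
  obtain ⟨I, hIS, -, h⟩ := exists_weightedRank_eq M w S
  exact h ▸ Finset.sum_le_sum_of_subset_of_nonneg hIS fun i _ _ => hw i

omit [DecidableEq E] in
lemma weightedRank_of_indep (hw : ∀ i, 0 ≤ w i) {S : Finset E} (hS : M.Indep (S : Set E)) :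
    weightedRank M w S = ∑ i ∈ S, w i :=
  (weightedRank_le hw S).antisymm (le_weightedRank subset_rfl hS)

end WeightedRank

/-! ### Matroid rank as a natural number -/

section Rank

variable {E : Type*} {M : Matroid E}

lemma cast_rank (M : Matroid E) (S : Finset E) : (rank M S : ℕ∞) = M.eRk (S : Set E) :=
  ENat.natCast_toNat (((M.eRk_le_encard _).trans_lt (Set.encard_lt_top_iff.2 S.finite_toSet)).ne)

lemma rank_mono (M : Matroid E) {S T : Finset E} (h : S ⊆ T) : rank M S ≤ rank M T := by
  have := M.eRk_mono (Finset.coe_subset.2 h)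
  rw [← cast_rank, ← cast_rank] at this
  exact_mod_cast this

lemma rank_le_card (M : Matroid E) (S : Finset E) : rank M S ≤ S.card := by
  have := M.eRk_le_encard (S : Set E)
  rw [← cast_rank, Set.encard_coe_eq_coe_finsetCard] at this
  exact_mod_cast this

lemma rank_inter_add_rank_union_le [DecidableEq E] (M : Matroid E) (S T : Finset E) :
    rank M (S ∩ T) + rank M (S ∪ T) ≤ rank M S + rank M T := by
  have := M.eRk_inter_add_eRk_union_le (S : Set E) (T : Set E)
  rw [← Finset.coe_inter, ← Finset.coe_union, ← cast_rank, ← cast_rank, ← cast_rank,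
    ← cast_rank] at this
  exact_mod_cast this

lemma card_le_rank {I S : Finset E} (hI : M.Indep (I : Set E)) (hIS : I ⊆ S) :
    I.card ≤ rank M S := by
  have := hI.encard_le_eRk_of_subset (Finset.coe_subset.2 hIS)
  rw [← cast_rank, Set.encard_coe_eq_coe_finsetCard] at this
  exact_mod_cast this

/-- An independent subset of `S` extends to a basis of `S`. -/
lemma exists_indep_card_eq_rank {I S : Finset E} (hI : M.Indep (I : Set E)) (hIS : I ⊆ S) :
    ∃ J : Finset E, I ⊆ J ∧ J ⊆ S ∧ M.Indep (J : Set E) ∧ J.card = rank M S := by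
  obtain ⟨J, hJ, hIJ⟩ := hI.subset_isBasis'_of_subset (Finset.coe_subset.2 hIS)
  obtain ⟨J, rfl⟩ := (S.finite_toSet.subset hJ.subset).exists_finset_coe
  refine ⟨J, by exact_mod_cast hIJ, by exact_mod_cast hJ.subset, hJ.indep, ?_⟩
  have := hJ.encard_eq_eRk
  rw [← cast_rank, Set.encard_coe_eq_coe_finsetCard] at this
  exact_mod_cast this

end Rank

end CorrelationGap

namespace CorrelationGap

/-! ### Independent set polytope, Edmonds' theorem, concave extension -/

section Polytope

variable {E : Type*} [Fintype E] [DecidableEq E] {M : Matroid E} {w x : E → ℝ}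

/-- The greedy bound: a nonnegative linear functional is bounded on the independent set
polytope by its value at some independent set. -/
lemma exists_indep_forall_sum_mul_le (M : Matroid E) (c : E → ℝ) (hc : ∀ i, 0 ≤ c i) :
    ∃ I : Finset E, M.Indep (I : Set E) ∧ I ⊆ supp c ∧
      ∀ x ∈ indepPolytope M, ∑ i, c i * x i ≤ ∑ i ∈ I, c i := by
  induction hn : (supp c).card using Nat.strong_induction_on generalizing c with
  | _ n ih =>
  subst hn
  set S := supp c with hS
  have memS : ∀ i, i ∈ S ↔ c i ≠ 0 := fun i => by simp [hS, supp]
  rcases S.eq_empty_or_nonempty with h0 | hne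
  · refine ⟨∅, by simp, by simp, fun x _ => ?_⟩
    have : ∀ i, c i = 0 := fun i => by
      by_contra h
      simpa [h0] using (memS i).2 h
    simp [this]
  · obtain ⟨j, hj, hmin⟩ := S.exists_min_image c hne
    have hm : 0 ≤ c j := hc j
    -- Subtracting the least positive coefficient from all of `S` kills `j`. The removed layer
    -- contributes `c j * x(S)`, at most `c j * r(S)`, and a basis `J` of `S` attains this bound.
    let c' : E → ℝ := fun i => if i ∈ S then c i - c j else 0
    have hc' : ∀ i, 0 ≤ c' i := fun i => by
      simp only [c']
      split_ifs with h
      · exact sub_nonneg.2 (hmin i h)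
      · exact le_rfl
    have hsub : supp c' ⊂ S := by
      refine (Finset.ssubset_iff_of_subset fun i hi => ?_).2 ⟨j, hj, by simp [supp, c']⟩
      by_contra h
      simp [supp, c', h] at hi
    obtain ⟨I, hI, hIS, hle⟩ := ih _ (Finset.card_lt_card hsub) c' hc' rfl
    obtain ⟨J, hIJ, hJS, hJ, hcard⟩ := exists_indep_card_eq_rank hI (hIS.trans hsub.1)
    refine ⟨J, hJ, hJS, fun x hx => ?_⟩
    have hsplit : ∑ i, c i * x i = ∑ i, c' i * x i + c j * ∑ i ∈ S, x i := by
      rw [show ∑ i ∈ S, x i = ∑ i, if i ∈ S then x i else 0 by simp, Finset.mul_sum, ← Finset.sum_add_distrib]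
      refine Finset.sum_congr rfl fun i _ => ?_
      by_cases h : i ∈ S
      · simp only [c', h, if_true]; ring
      · have : c i = 0 := by simpa [memS] using h
        simp [c', h, this]
    have hJc : ∑ i ∈ J, c i = ∑ i ∈ J, c' i + c j * J.card := by
      rw [mul_comm, ← nsmul_eq_mul, ← Finset.sum_const, ← Finset.sum_add_distrib]
      exact Finset.sum_congr rfl fun i hi => by simp [c', hJS hi]
    rw [hsplit, hJc, hcard]
    exact add_le_add ((hle x hx).trans
      (Finset.sum_le_sum_of_subset_of_nonneg hIJ fun i _ _ => hc' i))
      (mul_le_mul_of_nonneg_left (hx.2 S) hm)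

/-- Edmonds' theorem: every point of the independent set polytope is a convex combination of
indicator vectors of independent sets. -/
lemma exists_marginalDistribution_indep (hx : x ∈ indepPolytope M) :
    ∃ lam ∈ marginalDistributions x, ∀ S : Finset E, ¬ M.Indep (S : Set E) → lam S = 0 := by
  let D : Set (Finset E → ℝ) :=
    stdSimplex ℝ (Finset E) ∩ {lam | ∀ S : Finset E, ¬ M.Indep (S : Set E) → lam S = 0}
  let L : (Finset E → ℝ) →ₗ[ℝ] (E → ℝ) :=
    { toFun := fun lam i => ∑ S with i ∈ S, lam S
      map_add' := fun a b => by ext i; simp [Finset.sum_add_distrib]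
      map_smul' := fun a b => by ext i; simp [Finset.mul_sum] }
  have hDconv : Convex ℝ D := by
    refine (convex_stdSimplex ℝ _).inter fun a ha b hb s t _ _ _ S hS => ?_
    simp [ha S hS, hb S hS]
  have hDcomp : IsCompact D := by
    refine (isCompact_stdSimplex ℝ _).inter_right ?_
    simp only [Set.ofPred_forall]
    exact isClosed_iInter fun S => isClosed_iInter fun _ =>
      isClosed_eq (continuous_apply S) continuous_const
  have hLcont : Continuous L := LinearMap.continuous_of_finiteDimensional L
  suffices h : x ∈ L '' D by
    obtain ⟨lam, ⟨hlam, hind⟩, rfl⟩ := h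
    exact ⟨lam, ⟨hlam.1, hlam.2, fun i => rfl⟩, hind⟩
  by_contra hxD
  obtain ⟨f, u, hfu, hux⟩ := geometric_hahn_banach_closed_point (hDconv.linear_image L)
    (hDcomp.image hLcont).isClosed hxD
  let c : E → ℝ := fun i => f fun j => if i = j then 1 else 0
  have hf : ∀ z : E → ℝ, f z = ∑ i, z i * c i := fun z => by
    simpa using LinearMap.pi_apply_eq_sum_univ (f : (E → ℝ) →ₗ[ℝ] ℝ) z
  -- Passing to positive parts can only raise the functional at `x ≥ 0`, and leaves it unchanged on
  -- `I`, which lies in the support of the positive part.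
  obtain ⟨I, hI, hIsupp, hle⟩ :=
    exists_indep_forall_sum_mul_le M (fun i => max (c i) 0) fun i => le_max_right _ _
  have hmem : (fun i => if i ∈ I then (1 : ℝ) else 0) ∈ L '' D := by
    refine ⟨Pi.single I 1, ⟨single_mem_stdSimplex ℝ I, fun S hS => ?_⟩, ?_⟩
    · rw [Pi.single_eq_of_ne]
      rintro rfl
      exact hS hI
    · ext i
      change ∑ S with i ∈ S, (Pi.single I 1 : Finset E → ℝ) S = _
      rw [Finset.sum_filter, Finset.sum_eq_single I (fun S _ hS => by simp [hS]) (by simp)]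
      simp
  have h1 := hfu _ hmem
  have h2 : f (fun i => if i ∈ I then (1 : ℝ) else 0) = ∑ i ∈ I, max (c i) 0 := by
    rw [hf]
    simp only [ite_mul, one_mul, zero_mul, Finset.sum_ite_mem, Finset.univ_inter]
    refine Finset.sum_congr rfl fun i hi => ?_
    have : max (c i) 0 ≠ 0 := by simpa [supp] using hIsupp hi
    rcases le_total (c i) 0 with h | h
    · exact absurd (max_eq_right h) this
    · exact (max_eq_left h).symm
  have h3 : f x ≤ ∑ i, max (c i) 0 * x i := by
    rw [hf]
    exact Finset.sum_le_sum fun i _ => by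
      rw [mul_comm]
      exact mul_le_mul_of_nonneg_right (le_max_left _ _) (hx.1 i)
  have := hle x hx
  linarith

lemma sum_mul_sum_mem {lam : Finset E → ℝ} (hlam : lam ∈ marginalDistributions x) (w : E → ℝ) :
    ∑ S, lam S * ∑ i ∈ S, w i = ∑ i, w i * x i := by
  simp_rw [← hlam.2.2, Finset.mul_sum, Finset.sum_filter]
  rw [Finset.sum_comm]
  refine Finset.sum_congr rfl fun S _ => ?_
  simp [mul_comm]

lemma sum_mul_weightedRank_le (hw : ∀ i, 0 ≤ w i) {lam : Finset E → ℝ}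
    (hlam : lam ∈ marginalDistributions x) :
    ∑ S, lam S * weightedRank M w S ≤ ∑ i, w i * x i := by
  rw [← sum_mul_sum_mem hlam]
  exact Finset.sum_le_sum fun S _ => mul_le_mul_of_nonneg_left (weightedRank_le hw S) (hlam.1 S)

lemma sum_mul_le_concaveExt (hw : ∀ i, 0 ≤ w i) {lam : Finset E → ℝ}
    (hlam : lam ∈ marginalDistributions x) :
    ∑ S, lam S * weightedRank M w S ≤ concaveExt (weightedRank M w) x := by
  refine le_csSup ⟨∑ i, w i * x i, ?_⟩ ⟨lam, hlam, rfl⟩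
  rintro _ ⟨mu, hmu, rfl⟩
  exact sum_mul_weightedRank_le hw hmu

lemma multilinearExt_le_concaveExt (hw : ∀ i, 0 ≤ w i) (hx : ∀ i, 0 ≤ x i ∧ x i ≤ 1) :
    multilinearExt (weightedRank M w) x ≤ concaveExt (weightedRank M w) x := by
  rw [multilinearExt_eq]
  exact sum_mul_le_concaveExt hw (productWeight_mem_marginalDistributions hx)

lemma multilinearExt_le_sum (hw : ∀ i, 0 ≤ w i) (hx : ∀ i, 0 ≤ x i ∧ x i ≤ 1) :
    multilinearExt (weightedRank M w) x ≤ ∑ i, w i * x i := by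
  rw [multilinearExt_eq]
  exact sum_mul_weightedRank_le hw (productWeight_mem_marginalDistributions hx)

lemma multilinearExt_nonneg (hx : ∀ i, 0 ≤ x i ∧ x i ≤ 1) :
    0 ≤ multilinearExt (weightedRank M w) x := by
  rw [multilinearExt_eq]
  exact Finset.sum_nonneg fun S _ =>
    mul_nonneg (productWeight_nonneg hx S) (weightedRank_nonneg M w S)

/-- The bound `r_w(S) ≤ w(S)` is an equality on independent sets, and Edmonds' theorem gives a
distribution living on those. -/
lemma concaveExt_of_mem_indepPolytope (hw : ∀ i, 0 ≤ w i) (hx : x ∈ indepPolytope M) :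
    concaveExt (weightedRank M w) x = ∑ i, w i * x i := by
  obtain ⟨lam, hlam, hind⟩ := exists_marginalDistribution_indep hx
  apply le_antisymm
  · refine csSup_le ⟨_, lam, hlam, rfl⟩ ?_
    rintro _ ⟨mu, hmu, rfl⟩
    exact sum_mul_weightedRank_le hw hmu
  · refine le_trans (le_of_eq ?_) (sum_mul_le_concaveExt hw hlam)
    rw [← sum_mul_sum_mem hlam]
    refine Finset.sum_congr rfl fun S _ => ?_
    by_cases hS : M.Indep (S : Set E)
    · rw [weightedRank_of_indep hw hS]
    · rw [hind S hS, zero_mul, zero_mul]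

omit [Fintype E] [DecidableEq E] in
lemma le_one_of_mem_indepPolytope (hx : x ∈ indepPolytope M) (i : E) : x i ≤ 1 := by
  have h1 := hx.2 {i}
  have h2 : (rank M {i} : ℝ) ≤ 1 := by exact_mod_cast rank_le_card M {i}
  simpa using h1.trans h2

/-- The value of every distribution with marginals `x` is the weight of a point of the
independent set polytope below `x`. -/
lemma exists_mem_indepPolytope_le {lam : Finset E → ℝ} (hlam : lam ∈ marginalDistributions x) :
    ∃ y ∈ indepPolytope M, y ≤ x ∧
      ∑ i, w i * y i = ∑ S, lam S * weightedRank M w S := by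
  choose T hTS hT hTw using exists_weightedRank_eq M w
  have hcomm : ∀ (c : E → ℝ) (A : Finset E), ∑ i ∈ A, c i * ∑ S with i ∈ T S, lam S
      = ∑ S, lam S * ∑ i ∈ A ∩ T S, c i := by
    intro c A
    simp_rw [Finset.mul_sum, Finset.sum_filter]
    rw [Finset.sum_comm]
    refine Finset.sum_congr rfl fun S _ => ?_
    rw [← Finset.sum_filter, Finset.filter_mem_eq_inter]
    exact Finset.sum_congr rfl fun i _ => mul_comm _ _
  -- The witness is the probability that `i ∈ T S`. It lies in the polytope because `A ∩ T S` is
  -- independent, hence has at most `r(A)` elements.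
  refine ⟨fun i => ∑ S with i ∈ T S, lam S,
    ⟨fun i => Finset.sum_nonneg fun S _ => hlam.1 S, fun A => ?_⟩, fun i => ?_, ?_⟩
  · have := hcomm (fun _ => 1) A
    simp only [one_mul] at this
    rw [this]
    calc ∑ S, lam S * ∑ i ∈ A ∩ T S, (1 : ℝ) ≤ ∑ S, lam S * (rank M A : ℝ) := by
          refine Finset.sum_le_sum fun S _ => mul_le_mul_of_nonneg_left ?_ (hlam.1 S)
          rw [Finset.sum_const, nsmul_eq_mul, mul_one]
          exact_mod_cast card_le_rank ((hT S).subset (by simp)) Finset.inter_subset_left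
      _ = rank M A := by rw [← Finset.sum_mul, hlam.2.1, one_mul]
  · rw [← hlam.2.2 i]
    refine Finset.sum_le_sum_of_subset_of_nonneg (fun S hS => ?_) fun S _ _ => hlam.1 S
    simp only [Finset.mem_filter, Finset.mem_univ, true_and] at hS ⊢
    exact hTS S hS
  · rw [hcomm]
    exact Finset.sum_congr rfl fun S _ => by rw [Finset.univ_inter, hTw]

end Polytope

end CorrelationGap

namespace CorrelationGap

/-! ### Tight sets and moving to a tight support -/

section Tight

variable {E : Type*} [Fintype E] [DecidableEq E] {M : Matroid E} {w x : E → ℝ}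

omit [DecidableEq E] in
lemma mem_supp {i : E} : i ∈ supp x ↔ x i ≠ 0 := by simp [supp]

omit [DecidableEq E] in
lemma sum_supp_subset {S : Finset E} (h : supp x ⊆ S) : ∑ i ∈ S, x i = ∑ i ∈ supp x, x i :=
  (Finset.sum_subset h fun i _ hi => by simpa [mem_supp] using hi).symm

omit [Fintype E] in
lemma sum_update_eq (x : E → ℝ) (i : E) (t : ℝ) (S : Finset E) :
    ∑ j ∈ S, Function.update x i t j = ∑ j ∈ S, x j + if i ∈ S then t - x i else 0 := by
  split_ifs with h
  · rw [Finset.sum_update_of_mem h, ← Finset.add_sum_erase S x h, Finset.sdiff_singleton_eq_erase]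
    ring
  · rw [Finset.sum_update_of_notMem h, add_zero]

-- Uncrossing: by submodularity, slack at the union would force a violated constraint at the
-- intersection.
omit [Fintype E] in
lemma sum_union_eq_rank (hx : x ∈ indepPolytope M) {S T : Finset E}
    (hS : ∑ i ∈ S, x i = rank M S) (hT : ∑ i ∈ T, x i = rank M T) :
    ∑ i ∈ S ∪ T, x i = rank M (S ∪ T) := by
  have h1 : (rank M (S ∩ T) : ℝ) + rank M (S ∪ T) ≤ rank M S + rank M T := by
    exact_mod_cast rank_inter_add_rank_union_le M S T
  have h2 := Finset.sum_union_inter (s₁ := S) (s₂ := T) (f := x)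
  linarith [hx.2 (S ∩ T), hx.2 (S ∪ T)]

omit [DecidableEq E] in
/-- If a subset of a tight set contains the support, then it is tight too. -/
lemma sum_eq_rank_of_supp_subset (hx : x ∈ indepPolytope M) {S T : Finset E}
    (hT : ∑ i ∈ T, x i = rank M T) (hxS : supp x ⊆ S) (hST : S ⊆ T) :
    ∑ i ∈ S, x i = rank M S := by
  refine (hx.2 S).antisymm ?_
  rw [sum_supp_subset hxS, ← sum_supp_subset (hxS.trans hST), hT]
  exact_mod_cast rank_mono M hST

lemma sum_eq_rank_supp (hx : x ∈ indepPolytope M)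
    (h : ∀ i, x i ≠ 0 → ∃ S : Finset E, i ∈ S ∧ ∑ j ∈ S, x j = rank M S) :
    ∑ i, x i = rank M (supp x) := by
  have key : ∀ A ⊆ supp x, ∃ T : Finset E, A ⊆ T ∧ ∑ j ∈ T, x j = rank M T := by
    intro A
    induction A using Finset.induction_on with
    | empty => exact fun _ => ⟨∅, by simp, by
        rw [Finset.sum_empty, Nat.le_zero.1 (rank_le_card M ∅), Nat.cast_zero]⟩
    | insert i A _ ih =>
      intro hA
      obtain ⟨T, hAT, hT⟩ := ih ((Finset.subset_insert i A).trans hA)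
      obtain ⟨S, hiS, hS⟩ := h i (mem_supp.1 (hA (Finset.mem_insert_self i A)))
      exact ⟨S ∪ T, Finset.insert_subset (Finset.mem_union_left T hiS)
        (hAT.trans Finset.subset_union_right), sum_union_eq_rank hx hS hT⟩
  obtain ⟨T, hxT, hT⟩ := key _ subset_rfl
  rw [sum_supp_subset (Finset.subset_univ _)]
  exact sum_eq_rank_of_supp_subset hx hT subset_rfl hxT

open Classical in
/-- The elements of the support that lie in no tight set. -/
noncomputable def slackElements (M : Matroid E) (x : E → ℝ) : Finset E :=
  Finset.univ.filter fun i => x i ≠ 0 ∧ ∀ S : Finset E, i ∈ S → ∑ j ∈ S, x j ≠ rank M S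

/-- Since `i` lies in no tight set, changing its coordinate leaves every tight set tight, so no new
slack element arises. -/
lemma slackElements_update_ssubset {i : E} (hi : i ∈ slackElements M x) {t : ℝ}
    (ht : t = 0 ∨ ∃ S : Finset E, i ∈ S ∧ ∑ j ∈ S, Function.update x i t j = rank M S) :
    slackElements M (Function.update x i t) ⊂ slackElements M x := by
  have hi' := (Finset.mem_filter.1 hi).2
  have hn : i ∉ slackElements M (Function.update x i t) := by
    intro h
    obtain ⟨h1, h2⟩ := (Finset.mem_filter.1 h).2
    rcases ht with rfl | ⟨S, hiS, hS⟩
    · simp at h1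
    · exact h2 S hiS hS
  refine (Finset.ssubset_iff_of_subset fun j hj => ?_).2 ⟨i, hi, hn⟩
  have hji : j ≠ i := fun h => hn (h ▸ hj)
  obtain ⟨h1, h2⟩ := (Finset.mem_filter.1 hj).2
  rw [Function.update_of_ne hji] at h1
  refine Finset.mem_filter.2 ⟨Finset.mem_univ _, h1, fun S hjS hS => h2 S hjS ?_⟩
  rw [sum_update_eq, if_neg fun hiS => hi'.2 S hiS hS, add_zero, hS]

omit [Fintype E] in
lemma update_zero_mem_indepPolytope (hx : x ∈ indepPolytope M) (i : E) :
    Function.update x i 0 ∈ indepPolytope M := by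
  have hle : ∀ j, Function.update x i 0 j ≤ x j := fun j => by
    by_cases h : j = i
    · subst h; simpa using hx.1 j
    · simp [h]
  refine ⟨fun j => ?_, fun S => (Finset.sum_le_sum fun j _ => hle j).trans (hx.2 S)⟩
  by_cases h : j = i
  · subst h; simp
  · simpa [h] using hx.1 j

/-- Any coordinate can be increased until some set containing it becomes tight. -/
lemma exists_update_mem_indepPolytope (hx : x ∈ indepPolytope M) (i : E) :
    ∃ t, x i ≤ t ∧ Function.update x i t ∈ indepPolytope M ∧
      ∃ S : Finset E, i ∈ S ∧ ∑ j ∈ S, Function.update x i t j = rank M S := by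
  -- The smallest slack among the sets containing `i` is the largest admissible increase.
  obtain ⟨S, hS, hmin⟩ := (Finset.univ.filter fun S : Finset E => i ∈ S).exists_min_image
    (fun S => (rank M S : ℝ) - ∑ j ∈ S, x j) ⟨{i}, by simp⟩
  have hiS : i ∈ S := by simpa using hS
  have hd : 0 ≤ (rank M S : ℝ) - ∑ j ∈ S, x j := sub_nonneg.2 (hx.2 S)
  refine ⟨x i + (rank M S - ∑ j ∈ S, x j), by linarith, ⟨fun j => ?_, fun T => ?_⟩, S, hiS, ?_⟩
  · by_cases h : j = i
    · subst h
      have := hx.1 j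
      rw [Function.update_self]
      linarith
    · simpa [h] using hx.1 j
  · rw [sum_update_eq]
    split_ifs with hT
    · have := hmin T (by simpa using hT)
      linarith
    · simpa using hx.2 T
  · rw [sum_update_eq, if_pos hiS]
    ring

/-- A function that is affine in each coordinate and nonnegative at the points of the independent
set polytope whose support is tight is nonnegative on the polytope. -/
lemma nonneg_of_nonneg_of_tight {h : (E → ℝ) → ℝ} {W : Finset E}
    (haff : ∀ x i, ∃ a b : ℝ, ∀ t, h (Function.update x i t) = a + b * t)
    (hnn : ∀ x ∈ indepPolytope M, supp x ⊆ W → ∑ i, x i = rank M (supp x) → 0 ≤ h x)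
    (hx : x ∈ indepPolytope M) (hxW : supp x ⊆ W) : 0 ≤ h x := by
  induction hn : (slackElements M x).card using Nat.strong_induction_on generalizing x with
  | _ n ih =>
  subst hn
  rcases (slackElements M x).eq_empty_or_nonempty with h0 | ⟨i, hi⟩
  · refine hnn x hx hxW (sum_eq_rank_supp hx fun i hi => ?_)
    by_contra! hS
    have : i ∈ slackElements M x := Finset.mem_filter.2 ⟨Finset.mem_univ _, hi, hS⟩
    simp [h0] at this
  · have hxi : x i ≠ 0 := (Finset.mem_filter.1 hi).2.1
    have hsupp : ∀ t, supp (Function.update x i t) ⊆ W := fun t j hj => by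
      by_cases hji : j = i
      · exact hji ▸ hxW (mem_supp.2 hxi)
      · rw [mem_supp, Function.update_of_ne hji] at hj
        exact hxW (mem_supp.2 hj)
    obtain ⟨t, hxt, htP, htS⟩ := exists_update_mem_indepPolytope hx i
    have h1 := ih _ (Finset.card_lt_card (slackElements_update_ssubset hi (.inr htS))) htP
      (hsupp t) rfl
    have h2 := ih _ (Finset.card_lt_card (slackElements_update_ssubset hi (.inl rfl)))
      (update_zero_mem_indepPolytope hx i) (hsupp 0) rfl
    -- As `0 ≤ x i ≤ t`, the sign of the slope decides which endpoint bounds `h x` from below.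
    obtain ⟨a, b, hab⟩ := haff x i
    have h3 := hab (x i)
    rw [Function.update_eq_self] at h3
    rw [hab] at h1 h2
    rw [h3]
    have := hx.1 i
    rcases le_total 0 b with hb | hb
    · have := mul_nonneg hb this
      linarith
    · have := mul_le_mul_of_nonpos_left hxt hb
      linarith

end Tight

/-! ### Reduction to tight points and compactness -/

section Minimizer

variable {E : Type*} [Fintype E] [DecidableEq E] {M : Matroid E} {w x : E → ℝ}

/-- If `c` is a lower bound for the correlation ratio at the points of the independent set polytope
with tight support and positive weights on the support, then it is one on the whole cube. -/
lemma mul_concaveExt_le {c : ℝ} (hc : 0 ≤ c)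
    (hle : ∀ x ∈ indepPolytope M, supp x ⊆ supp w → ∑ i, x i = rank M (supp x) →
      c * ∑ i, w i * x i ≤ multilinearExt (weightedRank M w) x)
    (hx : ∀ i, 0 ≤ x i ∧ x i ≤ 1) :
    c * concaveExt (weightedRank M w) x ≤ multilinearExt (weightedRank M w) x := by
  have hsupp : ∀ y ∈ indepPolytope M, supp y ⊆ supp w →
      c * ∑ i, w i * y i ≤ multilinearExt (weightedRank M w) y := by
    intro y hy hyw
    refine sub_nonneg.1 (nonneg_of_nonneg_of_tight (W := supp w)
      (h := fun y => multilinearExt (weightedRank M w) y - c * ∑ i, w i * y i)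
      (fun y i => ?_) (fun y hy hyw ht => sub_nonneg.2 (hle y hy hyw ht)) hy hyw)
    obtain ⟨a, b, hab, -⟩ := exists_multilinearExt_update_eq (weightedRank M w) y i
    refine ⟨a - c * ∑ j ∈ Finset.univ.erase i, w j * y j, b - c * w i, fun t => ?_⟩
    rw [hab, ← Finset.add_sum_erase _ _ (Finset.mem_univ i), Function.update_self,
      Finset.sum_congr rfl fun j hj => by rw [Function.update_of_ne (Finset.ne_of_mem_erase hj)]]
    ring
  have hpoly : ∀ y ∈ indepPolytope M,
      c * ∑ i, w i * y i ≤ multilinearExt (weightedRank M w) y := by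
    intro y hy
    let z : E → ℝ := fun i => if w i = 0 then 0 else y i
    have hzy : z ≤ y := fun i => by
      simp only [z]
      split_ifs
      exacts [hy.1 i, le_rfl]
    have hz0 : ∀ i, 0 ≤ z i := fun i => by
      simp only [z]
      split_ifs
      exacts [le_rfl, hy.1 i]
    have hz : z ∈ indepPolytope M :=
      ⟨hz0, fun S => (Finset.sum_le_sum fun i _ => hzy i).trans (hy.2 S)⟩
    have hzw : supp z ⊆ supp w := fun i hi => by
      rw [mem_supp] at hi ⊢
      exact fun h => hi (by simp [z, h])
    have heq : ∑ i, w i * y i = ∑ i, w i * z i := Finset.sum_congr rfl fun i _ => by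
      by_cases h : w i = 0 <;> simp [z, h]
    rw [heq]
    exact (hsupp z hz hzw).trans (multilinearExt_mono (weightedRank_mono M w) hz0 hzy
      (le_one_of_mem_indepPolytope hy))
  -- The case `c = 0` is separate because the supremum is bounded by `R x / c`.
  rcases hc.eq_or_lt with rfl | hc'
  · simpa using multilinearExt_nonneg hx
  rw [← le_div_iff₀' hc']
  refine csSup_le ⟨_, _, productWeight_mem_marginalDistributions hx, rfl⟩ ?_
  rintro _ ⟨lam, hlam, rfl⟩
  obtain ⟨y, hy, hyx, hval⟩ := exists_mem_indepPolytope_le (M := M) (w := w) hlam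
  dsimp only
  rw [← hval, le_div_iff₀' hc']
  exact (hpoly y hy).trans (multilinearExt_mono (weightedRank_mono M w) hy.1 hyx fun i => (hx i).2)

/-- A point of the independent set polytope whose ratio is a lower bound at the points with tight
support attains the correlation gap. -/
lemma correlationGap_eq_ratio (hw : ∀ i, 0 ≤ w i) (hx : x ∈ indepPolytope M) {c : ℝ} (hc : 0 ≤ c)
    (hc1 : c ≤ 1)
    (hxc : ratio (multilinearExt (weightedRank M w) x) (∑ i, w i * x i) = c)
    (hle : ∀ x ∈ indepPolytope M, supp x ⊆ supp w → ∑ i, x i = rank M (supp x) →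
      c * ∑ i, w i * x i ≤ multilinearExt (weightedRank M w) x) :
    correlationGap (weightedRank M w) = c := by
  refine IsLeast.csInf_eq ⟨⟨x, fun i => ⟨hx.1 i, le_one_of_mem_indepPolytope hx i⟩, ?_⟩, ?_⟩
  · simp only [concaveExt_of_mem_indepPolytope hw hx, hxc]
  · rintro _ ⟨y, hy, rfl⟩
    have h1 := mul_concaveExt_le hc hle hy
    have h2 := multilinearExt_le_concaveExt (M := M) hw hy
    have h3 := multilinearExt_nonneg (M := M) (w := w) hy
    dsimp only [ratio]
    split_ifs with h
    · exact hc1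
    · rw [le_div_iff₀]
      · exact h1
      · refine (h3.trans h2).lt_of_ne fun h0 => h ⟨?_, h0.symm⟩
        exact le_antisymm (h2.trans h0.ge) h3

/-- The nonzero points of the independent set polytope with tight support and positive weights
on the support. -/
def tightPoints (M : Matroid E) (w : E → ℝ) : Set (E → ℝ) :=
  {x ∈ indepPolytope M | supp x ⊆ supp w ∧ ∑ i, x i = rank M (supp x) ∧ rank M (supp x) ≠ 0}

/-- Having a prescribed support is not a closed condition, but vanishing off `S` is. This exhibits
the set as a finite union of closed pieces of the polytope; a support smaller than `S` still has the
same rank. -/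
lemma tightPoints_eq (M : Matroid E) (w : E → ℝ) :
    tightPoints M w = ⋃ S ∈ {S : Finset E | S ⊆ supp w ∧ rank M S ≠ 0},
      {x ∈ indepPolytope M | (∀ i ∉ S, x i = 0) ∧ ∑ i, x i = rank M S} := by
  ext x
  simp only [tightPoints, Set.mem_iUnion, Set.mem_ofPred_eq, exists_prop]
  constructor
  · rintro ⟨hx, hxw, hs, hr⟩
    exact ⟨supp x, ⟨hxw, hr⟩, hx, fun i hi => by simpa [mem_supp] using hi, hs⟩
  · rintro ⟨S, ⟨hSw, hr⟩, hx, hxS, hs⟩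
    have hsub : supp x ⊆ S := fun i hi => by
      by_contra h
      exact mem_supp.1 hi (hxS i h)
    have hS : ∑ i ∈ S, x i = rank M S := by
      rw [sum_supp_subset hsub, ← hs, sum_supp_subset (Finset.subset_univ _)]
    have hxx := sum_eq_rank_of_supp_subset hx hS subset_rfl hsub
    have hxx' : ∑ i, x i = rank M (supp x) := by rw [sum_supp_subset (Finset.subset_univ _), hxx]
    refine ⟨hx, hsub.trans hSw, hxx', ?_⟩
    rw [hs] at hxx'
    exact (Nat.cast_injective hxx') ▸ hr

omit [Fintype E] [DecidableEq E] in
lemma isCompact_indepPolytope (M : Matroid E) : IsCompact (indepPolytope M) := by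
  refine (isCompact_Icc (a := (0 : E → ℝ)) (b := 1)).of_isClosed_subset ?_ fun x hx =>
    ⟨hx.1, le_one_of_mem_indepPolytope hx⟩
  have h1 : IsClosed {x : E → ℝ | ∀ i, 0 ≤ x i} := by
    simp only [Set.ofPred_forall]
    exact isClosed_iInter fun i => isClosed_le continuous_const (continuous_apply i)
  have h2 : IsClosed {x : E → ℝ | ∀ S : Finset E, ∑ i ∈ S, x i ≤ (rank M S : ℝ)} := by
    simp only [Set.ofPred_forall]
    exact isClosed_iInter fun S => isClosed_le (by fun_prop) continuous_const
  exact h1.inter h2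

lemma isCompact_tightPoints (M : Matroid E) (w : E → ℝ) : IsCompact (tightPoints M w) := by
  rw [tightPoints_eq]
  refine (Set.toFinite _).isCompact_biUnion fun S _ => (isCompact_indepPolytope M).inter_right ?_
  have h1 : IsClosed {x : E → ℝ | ∀ i ∉ S, x i = 0} := by
    simp only [Set.ofPred_forall]
    exact isClosed_iInter fun i => isClosed_iInter fun _ =>
      isClosed_eq (continuous_apply i) continuous_const
  exact h1.inter (isClosed_eq (by fun_prop) continuous_const)

omit [DecidableEq E] in
lemma sum_mul_pos_of_mem_tightPoints (hw : ∀ i, 0 ≤ w i) (hx : x ∈ tightPoints M w) :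
    0 < ∑ i, w i * x i := by
  obtain ⟨hxP, hxw, hs, hr⟩ := hx
  have hne : ∑ i, x i ≠ 0 := by rw [hs]; exact_mod_cast hr
  obtain ⟨i, -, hi⟩ := Finset.exists_ne_zero_of_sum_ne_zero hne
  refine Finset.sum_pos' (fun j _ => mul_nonneg (hw j) (hxP.1 j)) ⟨i, Finset.mem_univ i, ?_⟩
  exact mul_pos ((hw i).lt_of_ne' (mem_supp.1 (hxw (mem_supp.2 hi)))) ((hxP.1 i).lt_of_ne' hi)

omit [DecidableEq E] in
lemma eq_zero_or_mem_tightPoints (hx : x ∈ indepPolytope M) (hxw : supp x ⊆ supp w)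
    (hs : ∑ i, x i = rank M (supp x)) : x = 0 ∨ x ∈ tightPoints M w := by
  by_cases hr : rank M (supp x) = 0
  · rw [hr, Nat.cast_zero, Finset.sum_eq_zero_iff_of_nonneg fun i _ => hx.1 i] at hs
    exact .inl (funext fun i => hs i (Finset.mem_univ i))
  · exact .inr ⟨hx, hxw, hs, hr⟩

omit [Fintype E] [DecidableEq E] in
lemma zero_mem_indepPolytope (M : Matroid E) : (0 : E → ℝ) ∈ indepPolytope M :=
  ⟨fun _ => le_rfl, fun S => by simp⟩

end Minimizer

end CorrelationGap

/-! ### Attainment of the correlation gap -/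

open CorrelationGap in
theorem exists_tight_correlationGap_eq {E : Type*} [Fintype E] [DecidableEq E]
    (M : Matroid E) (w : E → ℝ) (hw : ∀ i, 0 ≤ w i) :
    ∃ x ∈ indepPolytope M, ∑ i, x i = (rank M (supp x) : ℝ) ∧
      correlationGap (weightedRank M w) =
        ratio (multilinearExt (weightedRank M w) x) (∑ i, w i * x i) := by
  have hR0 : 0 ≤ multilinearExt (weightedRank M w) 0 :=
    multilinearExt_nonneg fun _ => ⟨le_rfl, zero_le_one⟩
  -- Without nonzero tight points, 0 is the only point left to test, and its ratio is 1 by the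
  -- convention for `0 / 0`.
  rcases (tightPoints M w).eq_empty_or_nonempty with h0 | hne
  · have hR1 : multilinearExt (weightedRank M w) 0 ≤ ∑ i, w i * (0 : E → ℝ) i :=
      multilinearExt_le_sum hw fun _ => ⟨le_rfl, zero_le_one⟩
    have hR : multilinearExt (weightedRank M w) 0 = 0 := le_antisymm (by simpa using hR1) hR0
    have hr : ratio (multilinearExt (weightedRank M w) 0) (∑ i, w i * (0 : E → ℝ) i) = 1 := by
      simp [ratio, hR]
    refine ⟨0, zero_mem_indepPolytope M, sum_eq_rank_supp (zero_mem_indepPolytope M) (by simp), ?_⟩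
    rw [hr]
    refine correlationGap_eq_ratio hw (zero_mem_indepPolytope M) zero_le_one le_rfl hr ?_
    intro y hy hyw hys
    rcases eq_zero_or_mem_tightPoints hy hyw hys with rfl | h
    · simpa using hR0
    · simp [h0] at h
  · have hpos := fun x (hx : x ∈ tightPoints M w) => sum_mul_pos_of_mem_tightPoints hw hx
    obtain ⟨x, hx, hmin⟩ := (isCompact_tightPoints M w).exists_isMinOn hne
      (f := fun x => multilinearExt (weightedRank M w) x / ∑ i, w i * x i)
      ((continuous_multilinearExt _).continuousOn.div (by fun_prop) fun x hx => (hpos x hx).ne')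
    have hcube : ∀ i, 0 ≤ x i ∧ x i ≤ 1 := fun i => ⟨hx.1.1 i, le_one_of_mem_indepPolytope hx.1 i⟩
    have hr : ratio (multilinearExt (weightedRank M w) x) (∑ i, w i * x i) =
        multilinearExt (weightedRank M w) x / ∑ i, w i * x i :=
      if_neg fun h => (hpos x hx).ne' h.2
    refine ⟨x, hx.1, hx.2.2.1, ?_⟩
    rw [hr]
    refine correlationGap_eq_ratio hw hx.1 (div_nonneg (multilinearExt_nonneg hcube)
      (hpos x hx).le) ((div_le_one (hpos x hx)).2 (multilinearExt_le_sum hw hcube)) hr ?_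
    intro y hy hyw hys
    rcases eq_zero_or_mem_tightPoints hy hyw hys with rfl | h
    · simpa using hR0
    · exact (le_div_iff₀ (hpos y h)).1 (hmin h)

theorem mainTheorem3 {E : Type*} [Fintype E] [DecidableEq E]
    (M : Matroid E) (hM : M.E = Set.univ) (w : E → ℝ) (hw : ∀ i, 0 ≤ w i) :
    ∃ x ∈ CorrelationGap.indepPolytope M,
      ∑ i, x i = (CorrelationGap.rank M (CorrelationGap.supp x) : ℝ) ∧
      CorrelationGap.correlationGap (CorrelationGap.weightedRank M w) =
        CorrelationGap.ratio
          (CorrelationGap.multilinearExt (CorrelationGap.weightedRank M w) x)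
          (CorrelationGap.concaveExt (CorrelationGap.weightedRank M w) x) ∧
      CorrelationGap.correlationGap (CorrelationGap.weightedRank M w) =
        CorrelationGap.ratio
          (CorrelationGap.multilinearExt (CorrelationGap.weightedRank M w) x)
          (∑ i, w i * x i) := by
  obtain ⟨x, hx, hs, h⟩ := exists_tight_correlationGap_eq M w hw
  exact ⟨x, hx, hs, by rw [h, CorrelationGap.concaveExt_of_mem_indepPolytope hw hx], h⟩
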